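/- Let $X$ be a smooth real manifold of dimension $n$ (for instance a small neighbourhood of a point). Let $L$ be a smooth operator field (a $(1,1)$-tensor field) on $X$ that is Nijenhuis, i.e. $L^2[\xi,\eta]+[L\xi,L\eta]-L[L\xi,\eta]-L[\xi,L\eta]=0$ for all vector fields $\xi,\eta$; that is $\mathrm{gl}$-regular, i.e. at every point each complex eigenvalue of $L$ has geometric multiplicity one; and that is constant in suitable local coordinates around every point. Let $M$ be a smooth operator field that is a symmetry of $L$, i.e. $LM=ML$ and $M[L\xi,\xi]+L[\xi,M\xi]-[L\xi,M\xi]=0$ for all vector fields $\xi$. Then $M$ has a unique expansion $$M=g_1L^{n-1}+\dots+g_n\,\mathrm{Id}$$ with functions $g_1,\dots,g_n$. Assume that the symmetry $M$ is regular, i.e. $\mathrm dg_1,\dots,\mathrm dg_n$ are linearly independent at every point, and put $$T_M=\mathrm dg_1\otimes L^{n-1}+\dots+\mathrm dg_n\otimes\mathrm{Id},\qquad \xi\circ\eta=T_M(\xi,\eta).$$ Then there exists a unique smooth vector field $e$ on $X$ such that 1. $e$ is cyclic for $L$, i.e. $e,Le,\dots,L^{n-1}e$ are linearly independent at every point; 2.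 $\mathcal L_eL=0$; 3. $\mathcal L_eM=\mathrm{Id}$. Moreover, $(X,\circ,e,E)$ with $E=Me$ is an F-manifold: $\circ$ is a commutative associative product on vector fields with unity $e$; with $P_\xi(\zeta,\theta)=[\xi,\zeta\circ\theta]-[\xi,\zeta]\circ\theta-\zeta\circ[\xi,\theta]$ one has $$P_{\xi\circ\eta}(\zeta,\theta)=\xi\circ P_\eta(\zeta,\theta)+\eta\circ P_\xi(\zeta,\theta)$$ for all vector fields $\xi,\eta,\zeta,\theta$; and $E$ is an Euler vector field, i.e. $[E,\xi\circ\eta]-[E,\xi]\circ\eta-\xi\circ[E,\eta]=\xi\circ\eta$ for all vector fields $\xi,\eta$. In particular, $M$ is a Nijenhuis operator, so $(M,e)$ is a Nijenhuis operator with unity. -/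

import Mathlib

open scoped Manifold ContDiff
open Bundle

noncomputable section

namespace NijenhuisF

/-- Model space of an `n`-dimensional real manifold. -/
abbrev Model (n : ℕ) : Type := EuclideanSpace ℝ (Fin n)

section Manifold

variable {n : ℕ} {X : Type*} [TopologicalSpace X] [ChartedSpace (Model n) X]
  [IsManifold 𝓘(ℝ, Model n) ∞ X]

/-- The tangent space at `x`. -/
abbrev Tan (n : ℕ) {X : Type*} [TopologicalSpace X] [ChartedSpace (Model n) X] (x : X) : Type :=
  TangentSpace 𝓘(ℝ, Model n) x

/-- Vector fields on `X` (smoothness is a separate condition). -/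
abbrev VField (n : ℕ) (X : Type*) [TopologicalSpace X] [ChartedSpace (Model n) X] : Type _ :=
  (x : X) → Tan n x

/-- Operator fields, i.e. `(1,1)`-tensor fields (smoothness is a separate condition). -/
abbrev OpField (n : ℕ) (X : Type*) [TopologicalSpace X] [ChartedSpace (Model n) X] : Type _ :=
  (x : X) → Tan n x →L[ℝ] Tan n x

/-- Tensor fields of type `(1,2)` (smoothness is a separate condition). -/
abbrev BilField (n : ℕ) (X : Type*) [TopologicalSpace X] [ChartedSpace (Model n) X] : Type _ :=
  (x : X) → Tan n x →L[ℝ] Tan n x →L[ℝ] Tan n x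

/-- The vector field `V` is smooth on the set `U`. -/
def SmoothVFieldOn (V : VField n X) (U : Set X) : Prop :=
  ContMDiffOn 𝓘(ℝ, Model n) 𝓘(ℝ, Model n).tangent ∞
    (fun x => (⟨x, V x⟩ : TangentBundle 𝓘(ℝ, Model n) X)) U

/-- The vector field `V` is smooth on `X`. -/
def SmoothVField (V : VField n X) : Prop :=
  ContMDiff 𝓘(ℝ, Model n) 𝓘(ℝ, Model n).tangent ∞
    (fun x => (⟨x, V x⟩ : TangentBundle 𝓘(ℝ, Model n) X))

/-- The operator field `A` is a smooth section of the bundle `End (TX)`. -/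
def SmoothOpField (A : OpField n X) : Prop :=
  ContMDiff 𝓘(ℝ, Model n) (𝓘(ℝ, Model n).prod 𝓘(ℝ, Model n →L[ℝ] Model n)) ∞
    (fun x => TotalSpace.mk' (Model n →L[ℝ] Model n)
      (E := fun x : X => (Tan n x →L[ℝ] Tan n x)) x (A x))

/-- The commutator of vector fields. -/
abbrev bracket (V W : VField n X) : VField n X :=
  VectorField.mlieBracket 𝓘(ℝ, Model n) V W

/-- An operator field applied to a vector field. -/
abbrev app (A : OpField n X) (V : VField n X) : VField n X := fun x => A x (V x)

/-- The product of two vector fields defined by a tensor field of type `(1,2)`. -/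
abbrev prod (a : BilField n X) (V W : VField n X) : VField n X := fun x => a x (V x) (W x)

/-- The differential of a function. -/
def differential (f : X → ℝ) (x : X) : Tan n x →L[ℝ] ℝ :=
  mfderiv 𝓘(ℝ, Model n) 𝓘(ℝ, ℝ) f x

/-- Vanishing of the Nijenhuis torsion
`L² [V, W] + [L V, L W] - L [L V, W] - L [V, L W]` for all (local) smooth vector fields. -/
def IsNijenhuis (L : OpField n X) : Prop :=
  ∀ U : Set X, IsOpen U → ∀ V W : VField n X, SmoothVFieldOn V U → SmoothVFieldOn W U →
    ∀ x ∈ U,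
      L x (L x (bracket V W x)) + bracket (app L V) (app L W) x
        - L x (bracket (app L V) W x) - L x (bracket V (app L W) x) = 0

/-- Every eigenvalue of the complexification of each `L x` has geometric multiplicity one. -/
def IsGlRegular (L : OpField n X) : Prop :=
  ∀ (x : X) (μ : ℂ),
    Module.End.HasEigenvalue (((L x : Tan n x →ₗ[ℝ] Tan n x)).baseChange ℂ) μ →
      Module.finrank ℂ
        (Module.End.eigenspace (((L x : Tan n x →ₗ[ℝ] Tan n x)).baseChange ℂ) μ) = 1

/-- Around every point there are smooth local coordinates in which the matrix of `L`
is constant. -/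
def IsConstantInCoordinates (L : OpField n X) : Prop :=
  ∀ p : X, ∃ φ ∈ IsManifold.maximalAtlas 𝓘(ℝ, Model n) ∞ X, p ∈ φ.source ∧
    ∃ A : Model n →L[ℝ] Model n, ∀ x ∈ φ.source, ∀ v : Tan n x,
      mfderiv 𝓘(ℝ, Model n) 𝓘(ℝ, Model n) φ x (L x v)
        = A (mfderiv 𝓘(ℝ, Model n) 𝓘(ℝ, Model n) φ x v)

/-- The tensor `⟨L, M⟩ (V, W) = M [L V, W] + L [V, M W] - [L V, M W] - L M [V, W]`
of commuting operator fields. -/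
def nijBracket (L M : OpField n X) (V W : VField n X) : VField n X := fun x =>
  M x (bracket (app L V) W x) + L x (bracket V (app M W) x)
    - bracket (app L V) (app M W) x - L x (M x (bracket V W x))

/-- `M` is a symmetry of `L`: they commute and `⟨L, M⟩ (V, V) = 0` for all (local) smooth
vector fields `V`. -/
def IsSymmetry (L M : OpField n X) : Prop :=
  (∀ x v, L x (M x v) = M x (L x v)) ∧
  ∀ U : Set X, IsOpen U → ∀ V : VField n X, SmoothVFieldOn V U →
    ∀ x ∈ U, nijBracket L M V V x = 0

/-- The numbers `c i` are the coefficients of `M x` in `Id, L x, …, (L x) ^ (n - 1)`, highest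
power first. -/
def IsExpansionAt (L M : OpField n X) (x : X) (c : Fin n → ℝ) : Prop :=
  M x = ∑ i : Fin n, c i • (L x) ^ (n - 1 - (i : ℕ))

open Classical in
/-- The coefficient functions `g_i` in `M = g_0 L ^ (n - 1) + ⋯ + g_{n-1} Id`. If `L` is
gl-regular and commutes with `M`, they exist and are unique; the value `0` is used
where there is no such expansion. -/
def coeff (L M : OpField n X) (i : Fin n) (x : X) : ℝ :=
  if h : ∃ c : Fin n → ℝ, IsExpansionAt L M x c then h.choose i else 0

/-- `M` is a regular symmetry of `L`: the differentials of the coefficient functions are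
linearly independent at every point. -/
def IsRegularSymmetry (L M : OpField n X) : Prop :=
  IsSymmetry L M ∧
  ∀ x : X, LinearIndependent ℝ (fun i : Fin n => differential (n := n) (coeff L M i) x)

/-- `T_M = d g_0 ⊗ L ^ (n - 1) + ⋯ + d g_{n-1} ⊗ Id`. -/
def symmetryTensor (L M : OpField n X) : BilField n X := fun x =>
  ∑ i : Fin n,
    (differential (n := n) (coeff L M i) x).smulRight ((L x) ^ (n - 1 - (i : ℕ)))

/-- `e, L e, …, L ^ (n - 1) e` are linearly independent at every point. -/
def IsCyclic (L : OpField n X) (e : VField n X) : Prop :=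
  ∀ x : X, LinearIndependent ℝ (fun k : Fin n => ((L x) ^ (k : ℕ)) (e x))

/-- The Lie derivative of `A` along `e` is `B`, i.e. `[e, A V] - A [e, V] = B V` for all
(local) smooth vector fields `V`. -/
def LieDerivEq (e : VField n X) (A B : OpField n X) : Prop :=
  ∀ U : Set X, IsOpen U → ∀ V : VField n X, SmoothVFieldOn V U → ∀ x ∈ U,
    bracket e (app A V) x - A x (bracket e V x) = B x (V x)

/-- `e` is a smooth vector field, cyclic for `L`, whose Lie derivatives satisfy
`𝓛_e L = 0` and `𝓛_e M = Id`. -/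
structure IsUnityFor (L M : OpField n X) (e : VField n X) : Prop where
  smooth : SmoothVField e
  cyclic : IsCyclic L e
  lie_L : LieDerivEq e L (fun _ => 0)
  lie_M : LieDerivEq e M (fun x => ContinuousLinearMap.id ℝ (Tan n x))

/-- `(X, ∘, e, E)` is an F-manifold, where `V ∘ W = a (V, W)`: the product is smooth,
commutative and associative with unity `e`, it satisfies the Hertling–Manin condition
`P_{ξ∘η}(ζ, θ) = ξ ∘ P_η(ζ, θ) + η ∘ P_ξ(ζ, θ)` with
`P_ξ(ζ, θ) = [ξ, ζ∘θ] - [ξ, ζ]∘θ - ζ∘[ξ, θ]`, and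
`E` is an Euler vector field. -/
structure IsFManifold (a : BilField n X) (e E : VField n X) : Prop where
  smooth_mul : ∀ U : Set X, IsOpen U → ∀ V W : VField n X,
    SmoothVFieldOn V U → SmoothVFieldOn W U → SmoothVFieldOn (prod a V W) U
  smooth_unity : SmoothVField e
  smooth_euler : SmoothVField E
  comm : ∀ x u v, a x u v = a x v u
  assoc : ∀ x u v w, a x (a x u v) w = a x u (a x v w)
  unity : ∀ x v, a x (e x) v = v
  hertling_manin : ∀ U : Set X, IsOpen U → ∀ ξ η ζ θ : VField n X,
    SmoothVFieldOn ξ U → SmoothVFieldOn η U → SmoothVFieldOn ζ U → SmoothVFieldOn θ U →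
    ∀ x ∈ U,
      bracket (prod a ξ η) (prod a ζ θ) x
        - a x (bracket (prod a ξ η) ζ x) (θ x)
        - a x (ζ x) (bracket (prod a ξ η) θ x)
        - a x (ξ x) (bracket η (prod a ζ θ) x)
        + a x (a x (ξ x) (bracket η ζ x)) (θ x)
        + a x (a x (ξ x) (ζ x)) (bracket η θ x)
        - a x (η x) (bracket ξ (prod a ζ θ) x)
        + a x (a x (η x) (bracket ξ ζ x)) (θ x)
        + a x (a x (η x) (ζ x)) (bracket ξ θ x) = 0
  euler : ∀ U : Set X, IsOpen U → ∀ ξ η : VField n X,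
    SmoothVFieldOn ξ U → SmoothVFieldOn η U → ∀ x ∈ U,
      bracket E (prod a ξ η) x - a x (bracket E ξ x) (η x) - a x (ξ x) (bracket E η x)
        = a x (ξ x) (η x)

end Manifold

end NijenhuisF

end

/-!
In coordinates in which `L` is a constant operator `a`, gl-regularity makes the powers of `a` a
basis of the commutative algebra `R = ℝ[a]`, over which the model space is free of rank one. The
expansion of `M` defines the `R`-valued function `F = g_0 a ^ (n - 1) + ⋯ + g_{n-1}`. The symmetry
condition says that `dF (L ξ) = a dF ξ`, and regularity that `dF` is invertible, so `F` is a
coordinate map into `R` in which `L` becomes the multiplication by `a`, `M` the multiplication by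
the coordinate `F` itself, and `∘` the product of `R`. There `e` is the constant field `1`, `E` is
the field `F`, and every bracket identity is the Leibniz rule over `R`.
-/

noncomputable section

namespace NijenhuisF

section CyclicVector

open Polynomial Module

variable {K V : Type*} [Field K] [AddCommGroup V] [Module K V] [FiniteDimensional K V]

lemma finrank_ker_mul_le (f g : End K V) :
    finrank K (LinearMap.ker (f * g))
      ≤ finrank K (LinearMap.ker f) + finrank K (LinearMap.ker g) := by
  have hmaps : ∀ v ∈ LinearMap.ker (f * g), g v ∈ LinearMap.ker f :=
    fun v hv => LinearMap.mem_ker.1 hv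
  let q : LinearMap.ker (f * g) →ₗ[K] LinearMap.ker f := g.restrict hmaps
  have hker : finrank K (LinearMap.ker q) ≤ finrank K (LinearMap.ker g) := by
    rw [LinearMap.ker_restrict hmaps, ← Submodule.finrank_map_subtype_eq,
      Submodule.map_comap_subtype]
    exact Submodule.finrank_mono inf_le_right
  have hrange : finrank K (LinearMap.range q) ≤ finrank K (LinearMap.ker f) :=
    Submodule.finrank_le _
  have := q.finrank_range_add_finrank_ker
  omega

lemma finrank_ker_aeval_prod_le_card (f : End K V) (hf : ∀ μ, finrank K (f.eigenspace μ) ≤ 1)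
    (s : Multiset K) :
    finrank K (LinearMap.ker (aeval f (s.map fun r => X - C r).prod)) ≤ s.card := by
  induction s using Multiset.induction_on with
  | empty =>
    rw [Multiset.map_zero, Multiset.prod_zero, map_one, End.one_eq_id, LinearMap.ker_id,
      Multiset.card_zero, finrank_bot]
  | cons r s ih =>
    have hr : finrank K (LinearMap.ker (aeval f (X - C r))) ≤ 1 := by
      rw [map_sub, aeval_X, aeval_C, Algebra.algebraMap_eq_smul_one, ← End.eigenspace_def]
      exact hf r
    rw [Multiset.map_cons, Multiset.prod_cons, map_mul, Multiset.card_cons]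
    exact (finrank_ker_mul_le _ _).trans (by omega)

lemma finrank_le_natDegree_minpoly (E : Type*) [Field E] [IsAlgClosed E] [Algebra K E]
    (f : End K V) (hf : ∀ μ : E, finrank E (End.eigenspace (f.baseChange E) μ) ≤ 1) :
    finrank K V ≤ (minpoly K f).natDegree := by
  set p := (minpoly K f).map (algebraMap K E)
  have hroot : aeval (f.baseChange E) p = 0 := by
    rw [aeval_map_algebraMap]
    exact (aeval_algHom_apply (End.baseChangeHom K E V) f _).trans (by rw [minpoly.aeval, map_zero])
  have hsplit : p.Splits := IsAlgClosed.splits p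
  have hmonic : p.Monic := (minpoly.monic (Algebra.IsIntegral.isIntegral f)).map _
  calc finrank K V
      = finrank E (LinearMap.ker (aeval (f.baseChange E) p)) := by
        rw [hroot, LinearMap.ker_zero, finrank_top, finrank_baseChange]
    _ ≤ p.roots.card := by
        conv_lhs => rw [hsplit.eq_prod_roots_of_monic hmonic]
        exact finrank_ker_aeval_prod_le_card _ hf _
    _ = (minpoly K f).natDegree := by rw [← hsplit.natDegree_eq_card_roots, natDegree_map]

lemma exists_minpoly_dvd_of_aeval_apply_eq_zero (f : End K V) :
    ∃ v : V, ∀ p : K[X], aeval f p v = 0 → minpoly K f ∣ p := by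
  obtain ⟨x, hx⟩ := exists_ker_toSpanSingleton_eq_annihilator K[X] (AEval' f)
  obtain ⟨v, rfl⟩ := (AEval'.of f).surjective x
  refine ⟨v, fun p hp => ?_⟩
  rw [← Ideal.mem_span_singleton, span_minpoly_eq_annihilator, ← hx, LinearMap.mem_ker,
    LinearMap.toSpanSingleton_apply]
  exact (AEval.of_aeval_smul f p v).symm.trans (by rw [End.smul_def, hp, map_zero])

lemma exists_linearIndependent_pow_apply (E : Type*) [Field E] [IsAlgClosed E] [Algebra K E]
    (f : End K V) (hf : ∀ μ : E, finrank E (End.eigenspace (f.baseChange E) μ) ≤ 1) :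
    ∃ v : V, LinearIndependent K fun k : Fin (finrank K V) => (f ^ (k : ℕ)) v := by
  obtain ⟨v, hv⟩ := exists_minpoly_dvd_of_aeval_apply_eq_zero f
  refine ⟨v, Fintype.linearIndependent_iff.2 fun c hc i => ?_⟩
  set p : K[X] := ∑ k : Fin (finrank K V), C (c k) * X ^ (k : ℕ) with hp
  have hdvd : minpoly K f ∣ p := hv p (by simpa [hp, LinearMap.sum_apply] using hc)
  have hdeg : p.degree < (minpoly K f).degree :=
    (degree_sum_fin_lt c).trans_le <|
      (Nat.cast_le.2 (finrank_le_natDegree_minpoly E f hf)).trans_eq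
        (degree_eq_natDegree (minpoly.ne_zero (Algebra.IsIntegral.isIntegral f))).symm
  have hcoeff := congrArg (Polynomial.coeff · (i : ℕ)) (eq_zero_of_dvd_of_degree_lt hdvd hdeg)
  simpa [hp, finsetSum_coeff, coeff_X_pow, Fin.val_inj] using hcoeff

end CyclicVector

section EvalDesc

variable {K V : Type*} [Field K] [AddCommGroup V] [Module K V]

/-- The element `c 0 • a ^ (n - 1) + ⋯ + c (n - 1) • 1`, as a function of `c`: the coefficients are
listed from the highest power down, as in the expansion of a symmetry. -/
def evalDesc {n : ℕ} {A : Type*} [Ring A] [Algebra K A] (a : A) : (Fin n → K) →ₗ[K] A :=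
  Fintype.linearCombination K fun i => a ^ (n - 1 - (i : ℕ))

variable {n : ℕ} {A : Type*} [Ring A] [Algebra K A] [Module A V] [IsScalarTower K A V]
  {a b : A} {v : V}

lemma evalDesc_apply (a : A) (c : Fin n → K) :
    evalDesc a c = ∑ i, c i • a ^ (n - 1 - (i : ℕ)) :=
  Fintype.linearCombination_apply K _ c

lemma commute_evalDesc (h : Commute b a) (c : Fin n → K) : Commute b (evalDesc a c) := by
  rw [evalDesc_apply]
  exact Commute.sum_right _ _ _ fun i _ => (h.pow_right _).smul_right _

lemma map_evalDesc_smul {A' W : Type*} [Ring A'] [Algebra K A'] [AddCommGroup W] [Module K W]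
    [Module A' W] [IsScalarTower K A' W] {a' : A'} (D : V →ₗ[K] W)
    (hD : ∀ v, D (a • v) = a' • D v) (c : Fin n → K) (v : V) :
    D (evalDesc a c • v) = evalDesc a' c • D v := by
  have hpow (k : ℕ) : ∀ v, D (a ^ k • v) = a' ^ k • D v := by
    induction k with
    | zero => simp
    | succ k ih => intro v; rw [pow_succ, mul_smul, ih, hD, pow_succ, mul_smul]
  simp only [evalDesc_apply, Finset.sum_smul, map_sum, smul_assoc, map_smul, hpow]

lemma evalDesc_smul_injective (hv : LinearIndependent K fun k : Fin n => a ^ (k : ℕ) • v) :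
    Function.Injective fun c : Fin n → K => evalDesc a c • v := by
  have hrev : LinearIndependent K fun i : Fin n => a ^ (n - 1 - (i : ℕ)) • v := by
    convert hv.comp Fin.rev Fin.rev_injective using 4 with i
    rw [Function.comp_apply, Fin.val_rev]
    congr 2
    omega
  intro c d hcd
  refine linearIndependent_iff_injective_fintypeLinearCombination.1 hrev ?_
  simpa only [evalDesc_apply, Finset.sum_smul, smul_assoc, Fintype.linearCombination_apply]
    using hcd

variable [FiniteDimensional K V]

lemma evalDesc_smul_bijective (hn : Module.finrank K V = n)
    (hv : LinearIndependent K fun k : Fin n => a ^ (k : ℕ) • v) :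
    Function.Bijective fun c : Fin n → K => evalDesc a c • v := by
  let l : (Fin n → K) →ₗ[K] V := (LinearMap.toSpanSingleton A V v).restrictScalars K ∘ₗ evalDesc a
  have hl : Function.Injective l := evalDesc_smul_injective hv
  exact ⟨hl, (LinearMap.injective_iff_surjective_of_finrank_eq_finrank (by simp [hn])).1 hl⟩

variable [FaithfulSMul A V]

lemma existsUnique_eq_evalDesc (hn : Module.finrank K V = n)
    (hv : LinearIndependent K fun k : Fin n => a ^ (k : ℕ) • v) (hab : Commute b a) :
    ∃! c : Fin n → K, b = evalDesc a c := by
  have hbij := evalDesc_smul_bijective hn hv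
  obtain ⟨c, hc⟩ := hbij.2 (b • v)
  refine ⟨c, FaithfulSMul.eq_of_smul_eq_smul (α := V) fun w => ?_, fun d hd => hbij.1 ?_⟩
  · obtain ⟨d, rfl⟩ := hbij.2 w
    have hcd : Commute (evalDesc a c) (evalDesc a d) :=
      (commute_evalDesc (commute_evalDesc (Commute.refl a) c).symm d)
    simp only at hc ⊢
    rw [smul_smul, smul_smul, commute_evalDesc hab d, hcd, mul_smul, mul_smul, hc]
  · simp only [hc, hd]

lemma evalDesc_bijective {A : Type*} [CommRing A] [Algebra K A] [Module A V] [IsScalarTower K A V]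
    [FaithfulSMul A V] {a : A} (hn : Module.finrank K V = n)
    (hv : LinearIndependent K fun k : Fin n => a ^ (k : ℕ) • v) :
    Function.Bijective (evalDesc a : (Fin n → K) →ₗ[K] A) := by
  refine (Function.bijective_iff_existsUnique _).2 fun b => ?_
  simpa only [eq_comm] using existsUnique_eq_evalDesc hn hv (Commute.all b a)

lemma map_smul_of_diag (hn : Module.finrank K V = n)
    (hv : LinearIndependent K fun k : Fin n => a ^ (k : ℕ) • v) (τ : V →ₗ[K] A)
    (hτ : ∀ u, Commute (τ u) a) (hdiag : ∀ u, τ (a • u) • u = a • τ u • u) (u : V) :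
    τ (a • u) = a * τ u := by
  -- The defect `S` of `a`-linearity is alternating and commutes with the powers of `a`, which
  -- moves everything to `S v • v = 0`.
  have hbij := evalDesc_smul_bijective hn hv
  set S : V → A := fun u => τ (a • u) - a * τ u with hS
  have hcomm (u : V) (c : Fin n → K) (w : V) :
      S u • evalDesc a c • w = evalDesc a c • S u • w := by
    have : Commute (S u) a := (hτ _).sub_left ((Commute.refl a).mul_left (hτ u))
    rw [smul_smul, smul_smul, commute_evalDesc this c]
  have hself (u : V) : S u • u = 0 := by
    rw [sub_smul, mul_smul, hdiag, sub_self]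
  have hanti (u w : V) : S u • w = -(S w • u) := by
    have hadd : S (u + w) = S u + S w := by simp only [hS, smul_add, map_add, mul_add]; abel
    have h := hself (u + w)
    rw [hadd, smul_add, add_smul, add_smul, hself, hself, zero_add, add_zero] at h
    exact eq_neg_of_add_eq_zero_right h
  refine sub_eq_zero.1 (FaithfulSMul.eq_of_smul_eq_smul (α := V) fun w => ?_)
  change S u • w = (0 : A) • w
  obtain ⟨c, rfl⟩ := hbij.2 u
  obtain ⟨d, rfl⟩ := hbij.2 w
  simp only
  rw [hcomm, hanti, hcomm, hself, smul_zero, neg_zero, smul_zero, zero_smul]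

end EvalDesc

section Calculus

open Topology VectorField

variable {n : ℕ} {X : Type*} [TopologicalSpace X] [ChartedSpace (Model n) X]
  {B B' : Type*} [NormedAddCommGroup B] [NormedSpace ℝ B] [NormedAddCommGroup B'] [NormedSpace ℝ B']

local notation "𝓘ₙ" => 𝓘(ℝ, Model n)

instance finiteDimensional_tan (x : X) : FiniteDimensional ℝ (Tan n x) :=
  inferInstanceAs (FiniteDimensional ℝ (Model n))

lemma finrank_tan (x : X) : Module.finrank ℝ (Tan n x) = n :=
  (finrank_euclideanSpace_fin : Module.finrank ℝ (Model n) = n)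

/-- The derivative `V F` of a vector-valued function `F` along a vector field `V`. -/
def lieDeriv (F : X → B) (V : VField n X) : X → B := fun x => mvfderiv 𝓘ₙ F x (V x)

variable {F G : X → B} {U : Set X} {V W : VField n X} {x : X}

lemma mvfderiv_apply_congr (h : F =ᶠ[𝓝 x] G) (v : Tan n x) :
    mvfderiv 𝓘ₙ F x v = mvfderiv 𝓘ₙ G x v :=
  congrArg (fun l : Model n →L[ℝ] B => l v) h.mfderiv_eq

lemma mvfderiv_clm_comp (l : B →L[ℝ] B') (hF : MDifferentiableAt 𝓘ₙ 𝓘(ℝ, B) F x) (v : Tan n x) :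
    mvfderiv 𝓘ₙ (fun y => l (F y)) x v = l (mvfderiv 𝓘ₙ F x v) := by
  refine (mfderiv_comp_apply (I' := 𝓘(ℝ, B)) x (g := l) l.mdifferentiableAt hF v).trans ?_
  rw [ContinuousLinearMap.mfderiv_eq]
  rfl

lemma mvfderiv_ring_mul {R : Type*} [NormedCommRing R] [NormedAlgebra ℝ R] {f g : X → R}
    (hf : MDifferentiableAt 𝓘ₙ 𝓘(ℝ, R) f x) (hg : MDifferentiableAt 𝓘ₙ 𝓘(ℝ, R) g x) (v : Tan n x) :
    mvfderiv 𝓘ₙ (fun y => f y * g y) x v = f x * mvfderiv 𝓘ₙ g x v + g x * mvfderiv 𝓘ₙ f x v :=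
  congrArg (fun l : Model n →L[ℝ] R => l v) (hf.hasMFDerivAt.mul hg.hasMFDerivAt).mfderiv

lemma mdifferentiableAt_of_contMDiffOn (hU : IsOpen U) (hF : ContMDiffOn 𝓘ₙ 𝓘(ℝ, B) ∞ F U)
    (hx : x ∈ U) :
    MDifferentiableAt 𝓘ₙ 𝓘(ℝ, B) F x :=
  (hF.contMDiffAt (hU.mem_nhds hx)).mdifferentiableAt (by simp)

lemma mvfderiv_apply_eq_zero_of_forall_eq (hU : IsOpen U) {c : B} (hF : ∀ y ∈ U, F y = c)
    (hx : x ∈ U) (v : Tan n x) : mvfderiv 𝓘ₙ F x v = 0 := by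
  have hev : F =ᶠ[𝓝 x] fun _ => c := by filter_upwards [hU.mem_nhds hx] with y hy using hF y hy
  rw [mvfderiv_apply_congr hev, mvfderiv_const]
  rfl

lemma contMDiffOn_ring_mul {R : Type*} [NormedCommRing R] [NormedAlgebra ℝ R] {f g : X → R}
    (hf : ContMDiffOn 𝓘ₙ 𝓘(ℝ, R) ∞ f U) (hg : ContMDiffOn 𝓘ₙ 𝓘(ℝ, R) ∞ g U) :
    ContMDiffOn 𝓘ₙ 𝓘(ℝ, R) ∞ (fun y => f y * g y) U :=
  (contDiff_mul (𝕜 := ℝ) (𝔸 := R)).contMDiff.comp_contMDiffOn (hf.prodMk_space hg)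

variable [IsManifold 𝓘(ℝ, Model n) ∞ X]

lemma contMDiffOn_lieDeriv (hU : IsOpen U) (hF : ContMDiffOn 𝓘ₙ 𝓘(ℝ, B) ∞ F U)
    (hV : SmoothVFieldOn V U) :
    ContMDiffOn 𝓘ₙ 𝓘(ℝ, B) ∞ (lieDeriv F V) U := by
  have hT := (hF.contMDiffOn_tangentMapWithin (m := ∞) (by simp) hU.uniqueMDiffOn).comp hV
    fun y hy => hy
  refine ((contMDiff_snd_tangentBundle_modelSpace (n := ∞) B 𝓘(ℝ, B)).comp_contMDiffOn hT).congr
    fun y hy => ?_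
  change _ = mfderivWithin 𝓘ₙ 𝓘(ℝ, B) F U y (V y)
  rw [mfderivWithin_of_isOpen hU hy]
  rfl

lemma fderiv_comp_symm_mpullback {y : Model n} (hy : y ∈ (extChartAt 𝓘ₙ x).target)
    (hF : MDifferentiableAt 𝓘ₙ 𝓘(ℝ, B) F ((extChartAt 𝓘ₙ x).symm y)) (V : VField n X) :
    fderiv ℝ (F ∘ (extChartAt 𝓘ₙ x).symm) y
        (mpullback 𝓘ₙ 𝓘ₙ (extChartAt 𝓘ₙ x).symm V y)
      = lieDeriv F V ((extChartAt 𝓘ₙ x).symm y) := by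
  have hinv := isInvertible_mfderivWithin_extChartAt_symm hy
  rw [ModelWithCorners.range_eq_univ, mfderivWithin_univ] at hinv
  rw [← mfderiv_eq_fderiv]
  refine (mfderiv_comp_apply (I' := 𝓘ₙ) y hF
    (mdifferentiableAt_of_isInvertible_mfderiv hinv) _).trans ?_
  exact congrArg (mvfderiv 𝓘ₙ F _) (hinv.self_apply_inverse _)

lemma contDiffAt_mpullback_extChartAt_symm (hU : U ∈ 𝓝 x) (hV : SmoothVFieldOn V U) :
    ContDiffAt ℝ ∞ (mpullback 𝓘ₙ 𝓘ₙ (extChartAt 𝓘ₙ x).symm V : Model n → Model n)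
      (extChartAt 𝓘ₙ x x) := by
  have hinv := isInvertible_mfderivWithin_extChartAt_symm (mem_extChartAt_target (I := 𝓘ₙ) x)
  rw [ModelWithCorners.range_eq_univ, mfderivWithin_univ] at hinv
  refine contMDiffAt_vectorSpace_iff_contDiffAt.1 (ContMDiffAt.mpullback_vectorField_preimage
    (n := ∞) (hV.contMDiffAt ?_)
    ((contMDiffOn_extChartAt_symm x).contMDiffAt (extChartAt_target_mem_nhds x)) hinv (by simp))
  rwa [extChartAt_to_inv]

lemma fderiv_fderiv_comp_symm_mpullback (hU : IsOpen U) (hF : ContMDiffOn 𝓘ₙ 𝓘(ℝ, B) ∞ F U)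
    (hW : SmoothVFieldOn W U) (hx : x ∈ U) (V : VField n X) :
    fderiv ℝ (fun y => fderiv ℝ (F ∘ (extChartAt 𝓘ₙ x).symm) y
        (mpullback 𝓘ₙ 𝓘ₙ (extChartAt 𝓘ₙ x).symm W y)) (extChartAt 𝓘ₙ x x)
        (mpullback 𝓘ₙ 𝓘ₙ (extChartAt 𝓘ₙ x).symm V (extChartAt 𝓘ₙ x x))
      = mvfderiv 𝓘ₙ (lieDeriv F W) x (V x) := by
  set ψ := extChartAt 𝓘ₙ x
  have hψx : ψ.symm (ψ x) = x := extChartAt_to_inv x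
  have hev : (fun y => fderiv ℝ (F ∘ ψ.symm) y (mpullback 𝓘ₙ 𝓘ₙ ψ.symm W y)) =ᶠ[𝓝 (ψ x)]
      lieDeriv F W ∘ ψ.symm := by
    filter_upwards [extChartAt_target_mem_nhds x,
      (continuousAt_extChartAt_symm x).preimage_mem_nhds (hU.mem_nhds (hψx.symm ▸ hx))]
      with y hy hyU
    exact fderiv_comp_symm_mpullback hy (mdifferentiableAt_of_contMDiffOn hU hF hyU) W
  have h := fderiv_comp_symm_mpullback (mem_extChartAt_target x)
    (mdifferentiableAt_of_contMDiffOn hU (contMDiffOn_lieDeriv hU hF hW) (hψx.symm ▸ hx)) V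
  rwa [← hev.fderiv_eq, hψx] at h

lemma mvfderiv_bracket (hU : IsOpen U) (hF : ContMDiffOn 𝓘ₙ 𝓘(ℝ, B) ∞ F U)
    (hV : SmoothVFieldOn V U) (hW : SmoothVFieldOn W U) (hx : x ∈ U) :
    mvfderiv 𝓘ₙ F x (bracket V W x)
      = mvfderiv 𝓘ₙ (lieDeriv F W) x (V x) - mvfderiv 𝓘ₙ (lieDeriv F V) x (W x) := by
  have hmin : minSmoothness ℝ 2 ≤ ∞ := by
    rw [minSmoothness_of_isRCLikeNormedField]; exact WithTop.coe_le_coe.2 le_top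
  have : IsManifold 𝓘ₙ (minSmoothness ℝ 2) X := IsManifold.of_le hmin
  set ψ := extChartAt 𝓘ₙ x
  have hψx : ψ.symm (ψ x) = x := extChartAt_to_inv x
  have hxU : ψ.symm (ψ x) ∈ U := hψx.symm ▸ hx
  have hUψ : U ∈ 𝓝 (ψ.symm (ψ x)) := hU.mem_nhds hxU
  have hψ : ContMDiffAt 𝓘ₙ 𝓘ₙ ∞ ψ.symm (ψ x) :=
    (contMDiffOn_extChartAt_symm x).contMDiffAt (extChartAt_target_mem_nhds x)
  let pull (Z : VField n X) : Model n → Model n := mpullback 𝓘ₙ 𝓘ₙ ψ.symm Z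
  have hpull : pull (bracket V W) (ψ x) = lieBracket ℝ (pull V) (pull W) (ψ x) := by
    rw [← lieBracketWithin_univ]
    refine (mpullback_mlieBracket (n := ∞) ((hV.contMDiffAt hUψ).mdifferentiableAt (by simp))
      ((hW.contMDiffAt hUψ).mdifferentiableAt (by simp)) hψ hmin).trans ?_
    rw [← mlieBracketWithin_univ, mlieBracketWithin_eq_lieBracketWithin]
  have hdiff {Z : VField n X} (hZ : SmoothVFieldOn Z U) : DifferentiableAt ℝ (pull Z) (ψ x) :=
    (contDiffAt_mpullback_extChartAt_symm (hU.mem_nhds hx) hZ).differentiableAt (by simp)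
  calc mvfderiv 𝓘ₙ F x (bracket V W x)
      = fderiv ℝ (F ∘ ψ.symm) (ψ x) (pull (bracket V W) (ψ x)) := by
        rw [fderiv_comp_symm_mpullback (mem_extChartAt_target x)
          (mdifferentiableAt_of_contMDiffOn hU hF hxU), hψx]
        rfl
    _ = _ := by
        rw [hpull, fderiv_apply_lieBracket ((hF.contMDiffAt hUψ).comp _ hψ).contDiffAt hmin
          (hdiff hW) (hdiff hV), fderiv_fderiv_comp_symm_mpullback hU hF hW hx,
          fderiv_fderiv_comp_symm_mpullback hU hF hV hx]

lemma smoothVFieldOn_app {A : OpField n X} (hA : SmoothOpField A) (hV : SmoothVFieldOn V U) :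
    SmoothVFieldOn (app A V) U := by
  have : IsManifold 𝓘ₙ (∞ + 1) X := by simpa
  exact ContMDiffOn.clm_bundle_apply (F₁ := Model n) (F₂ := Model n) hA.contMDiffOn hV

end Calculus

section CoordinateMap

open VectorField

variable {n : ℕ} {X : Type*} [TopologicalSpace X] [ChartedSpace (Model n) X]
  {B : Type*} [NormedAddCommGroup B] [NormedSpace ℝ B]

local notation "𝓘ₙ" => 𝓘(ℝ, Model n)

/-- `F` is a smooth vector-valued map on the open set `U` with bijective derivatives, i.e. a local
coordinate system with values in a vector space isomorphic to `ℝⁿ`. -/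
structure IsCoordinateMap (n : ℕ) {X : Type*} [TopologicalSpace X] [ChartedSpace (Model n) X]
    (F : X → B) (U : Set X) : Prop where
  isOpen : IsOpen U
  contMDiffOn : ContMDiffOn 𝓘(ℝ, Model n) 𝓘(ℝ, B) ∞ F U
  bijective : ∀ x ∈ U, Function.Bijective (mvfderiv 𝓘(ℝ, Model n) F x)

namespace IsCoordinateMap

lemma of_mem_maximalAtlas {φ : OpenPartialHomeomorph X (Model n)}
    (hφ : φ ∈ IsManifold.maximalAtlas 𝓘ₙ ∞ X) : IsCoordinateMap n φ φ.source where
  isOpen := φ.open_source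
  contMDiffOn := contMDiffOn_of_mem_maximalAtlas hφ
  bijective _ hx := OpenPartialHomeomorph.MDifferentiable.mfderiv_bijective
    ⟨(contMDiffOn_of_mem_maximalAtlas hφ).mdifferentiableOn (by simp),
      (contMDiffOn_symm_of_mem_maximalAtlas hφ).mdifferentiableOn (by simp)⟩ hx

variable {F : X → B} {U : Set X} {V W : VField n X} {x : X}

lemma mono (hF : IsCoordinateMap n F U) {U' : Set X} (hU' : IsOpen U') (h : U' ⊆ U) :
    IsCoordinateMap n F U' :=
  ⟨hU', hF.contMDiffOn.mono h, fun x hx => hF.bijective x (h hx)⟩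

lemma isInvertible_mfderiv (hF : IsCoordinateMap n F U) (hx : x ∈ U) :
    (mfderiv 𝓘ₙ 𝓘(ℝ, B) F x).IsInvertible := by
  let l : Model n →L[ℝ] B := mvfderiv 𝓘ₙ F x
  let φ := LinearEquiv.ofBijective (l : Model n →ₗ[ℝ] B) (hF.bijective x hx)
  exact ⟨φ.toContinuousLinearEquiv, by ext; rfl⟩

lemma finiteDimensional (hF : IsCoordinateMap n F U) (hx : x ∈ U) : FiniteDimensional ℝ B :=
  Module.Finite.of_surjective (mvfderiv 𝓘ₙ F x : Tan n x →ₗ[ℝ] B) (hF.bijective x hx).2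

lemma finrank_eq (hF : IsCoordinateMap n F U) (hx : x ∈ U) : Module.finrank ℝ B = n :=
  (LinearEquiv.ofBijective (mvfderiv 𝓘ₙ F x : Tan n x →ₗ[ℝ] B)
    (hF.bijective x hx)).finrank_eq.symm.trans (finrank_tan x)

/-- The vector field whose coordinates with respect to `F` are the constant `c`. -/
def constField (n : ℕ) {X : Type*} [TopologicalSpace X] [ChartedSpace (Model n) X] (F : X → B)
    (c : B) : VField n X :=
  mpullback 𝓘(ℝ, Model n) 𝓘(ℝ, B) F fun _ => c

lemma lieDeriv_constField (hF : IsCoordinateMap n F U) (hx : x ∈ U) (c : B) :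
    lieDeriv F (constField n F c) x = c :=
  (hF.isInvertible_mfderiv hx).self_apply_inverse c

variable [IsManifold 𝓘(ℝ, Model n) ∞ X]

lemma smoothVFieldOn_constField (hF : IsCoordinateMap n F U) (c : B) :
    SmoothVFieldOn (constField n F c) U := by
  intro x hx
  have hc : ContMDiffAt 𝓘(ℝ, B) 𝓘(ℝ, B).tangent ∞
      (fun y => (⟨y, c⟩ : TangentBundle 𝓘(ℝ, B) B)) (F x) :=
    contMDiffAt_vectorSpace_iff_contDiffAt.2 contDiffAt_const
  have := hF.finiteDimensional hx
  exact (ContMDiffAt.mpullback_vectorField_preimage hc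
    (hF.contMDiffOn.contMDiffAt (hF.isOpen.mem_nhds hx)) (hF.isInvertible_mfderiv hx)
    (by simp)).contMDiffWithinAt

lemma exists_smoothVFieldOn_apply_eq (hF : IsCoordinateMap n F U) (hx : x ∈ U) (v : Tan n x) :
    ∃ V : VField n X, SmoothVFieldOn V U ∧ V x = v :=
  ⟨constField n F (mvfderiv 𝓘ₙ F x v), hF.smoothVFieldOn_constField _,
    (hF.bijective x hx).1 (hF.lieDeriv_constField hx _)⟩

lemma smoothVFieldOn_of_lieDeriv (hF : IsCoordinateMap n F U)
    (hV : ContMDiffOn 𝓘ₙ 𝓘(ℝ, B) ∞ (lieDeriv F V) U) : SmoothVFieldOn V U := by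
  intro x hx
  have := hF.finiteDimensional hx
  let b := Module.finBasis ℝ B
  let coord (i) : B →L[ℝ] ℝ := LinearMap.toContinuousLinearMap (b.coord i)
  have hsum : SmoothVFieldOn (n := n)
      (fun y => ∑ i, coord i (lieDeriv F V y) • constField n F (b i) y) U :=
    ContMDiffOn.sum_section fun i _ =>
      ((coord i).contMDiff.comp_contMDiffOn hV).smul_section (hF.smoothVFieldOn_constField (b i))
  have hVsum (y) (hy : y ∈ U) : V y = ∑ i, coord i (lieDeriv F V y) • constField n F (b i) y := by
    apply (hF.bijective y hy).1
    rw [map_sum]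
    simp only [map_smul]
    change lieDeriv F V y = ∑ i, b.coord i (lieDeriv F V y) • lieDeriv F (constField n F (b i)) y
    simp only [hF.lieDeriv_constField hy, Module.Basis.coord_apply, b.sum_repr]
  exact (hsum x hx).congr (fun y hy => by rw [hVsum y hy]) (by rw [hVsum x hx])

lemma mdifferentiableAt_lieDeriv (hF : IsCoordinateMap n F U) (hV : SmoothVFieldOn V U)
    (hx : x ∈ U) : MDifferentiableAt 𝓘ₙ 𝓘(ℝ, B) (lieDeriv F V) x :=
  mdifferentiableAt_of_contMDiffOn hF.isOpen (contMDiffOn_lieDeriv hF.isOpen hF.contMDiffOn hV) hx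

lemma map_bracket (hF : IsCoordinateMap n F U) (hV : SmoothVFieldOn V U) (hW : SmoothVFieldOn W U)
    (hx : x ∈ U) :
    mvfderiv 𝓘ₙ F x (bracket V W x)
      = mvfderiv 𝓘ₙ (lieDeriv F W) x (V x) - mvfderiv 𝓘ₙ (lieDeriv F V) x (W x) :=
  mvfderiv_bracket hF.isOpen hF.contMDiffOn hV hW hx

end IsCoordinateMap

end CoordinateMap

section AlgebraChart

open Topology

variable {n : ℕ} {X : Type*} [TopologicalSpace X] [ChartedSpace (Model n) X]
  {R : Type*} [NormedCommRing R] [NormedAlgebra ℝ R]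

local notation "𝓘ₙ" => 𝓘(ℝ, Model n)

/-- In the algebra-valued coordinates `F`, the operator field `A` is the multiplication by the
function `h`, and `h` is differentiable over the algebra, with derivative `h'`. -/
structure IsMulBy (F : X → R) (U : Set X) (A : OpField n X) (h h' : X → R) : Prop where
  contMDiffOn : ContMDiffOn 𝓘(ℝ, Model n) 𝓘(ℝ, R) ∞ h U
  map_app : ∀ x ∈ U, ∀ v, mvfderiv 𝓘(ℝ, Model n) F x (A x v) = h x * mvfderiv 𝓘(ℝ, Model n) F x v
  mvfderiv_eq : ∀ x ∈ U, ∀ v,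
    mvfderiv 𝓘(ℝ, Model n) h x v = h' x * mvfderiv 𝓘(ℝ, Model n) F x v

namespace IsMulBy

variable [IsManifold 𝓘(ℝ, Model n) ∞ X] {F : X → R} {U : Set X} {A : OpField n X} {h h' : X → R}
  {V W : VField n X} {x : X}

lemma smoothVFieldOn_app (hA : IsMulBy F U A h h') (hF : IsCoordinateMap n F U)
    (hV : SmoothVFieldOn V U) : SmoothVFieldOn (app A V) U :=
  hF.smoothVFieldOn_of_lieDeriv <|
    (contMDiffOn_ring_mul hA.contMDiffOn (contMDiffOn_lieDeriv hF.isOpen hF.contMDiffOn hV)).congr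
      fun y hy => hA.map_app y hy (V y)

lemma mvfderiv_lieDeriv_app (hA : IsMulBy F U A h h') (hF : IsCoordinateMap n F U)
    (hV : SmoothVFieldOn V U) (hx : x ∈ U) (v : Tan n x) :
    mvfderiv 𝓘ₙ (lieDeriv F (app A V)) x v
      = h x * mvfderiv 𝓘ₙ (lieDeriv F V) x v + lieDeriv F V x * (h' x * mvfderiv 𝓘ₙ F x v) := by
  have hev : lieDeriv F (app A V) =ᶠ[𝓝 x] fun y => h y * lieDeriv F V y := by
    filter_upwards [hF.isOpen.mem_nhds hx] with y hy using hA.map_app y hy (V y)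
  rw [mvfderiv_apply_congr hev, mvfderiv_ring_mul
    (mdifferentiableAt_of_contMDiffOn hF.isOpen hA.contMDiffOn hx)
    (hF.mdifferentiableAt_lieDeriv hV hx), hA.mvfderiv_eq x hx]

lemma torsion_eq_zero (hA : IsMulBy F U A h h') (hF : IsCoordinateMap n F U)
    (hV : SmoothVFieldOn V U) (hW : SmoothVFieldOn W U) (hx : x ∈ U) :
    A x (A x (bracket V W x)) + bracket (app A V) (app A W) x
      - A x (bracket (app A V) W x) - A x (bracket V (app A W) x) = 0 := by
  have hAV := hA.smoothVFieldOn_app hF hV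
  have hAW := hA.smoothVFieldOn_app hF hW
  apply (hF.bijective x hx).1
  simp only [map_sub, map_add, map_zero, hA.map_app x hx, hF.map_bracket hV hW hx,
    hF.map_bracket hAV hAW hx, hF.map_bracket hAV hW hx, hF.map_bracket hV hAW hx,
    hA.mvfderiv_lieDeriv_app hF hV hx, hA.mvfderiv_lieDeriv_app hF hW hx]
  ring

lemma map_bracket_app_sub (hA : IsMulBy F U A h h') (hF : IsCoordinateMap n F U)
    (hV : SmoothVFieldOn V U) (hW : SmoothVFieldOn W U) (hx : x ∈ U) :
    mvfderiv 𝓘ₙ F x (bracket V (app A W) x - A x (bracket V W x))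
      = h' x * lieDeriv F V x * lieDeriv F W x + h x * mvfderiv 𝓘ₙ (lieDeriv F V) x (W x)
        - mvfderiv 𝓘ₙ (lieDeriv F V) x (A x (W x)) := by
  have hAW := hA.smoothVFieldOn_app hF hW
  simp only [map_sub, hA.map_app x hx, hF.map_bracket hV hW hx, hF.map_bracket hV hAW hx,
    hA.mvfderiv_lieDeriv_app hF hW hx]
  simp only [lieDeriv]
  ring

end IsMulBy

instance clm_isScalarTower {V : Type*} [AddCommGroup V] [Module ℝ V] [TopologicalSpace V]
    [IsTopologicalAddGroup V] [ContinuousConstSMul ℝ V] : IsScalarTower ℝ (V →L[ℝ] V) V :=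
  ⟨fun _ _ _ => rfl⟩

/-- The Leibniz defect `P_ξ(ζ, θ) = [ξ, ζ ∘ θ] - [ξ, ζ] ∘ θ - ζ ∘ [ξ, θ]` of the product given
by `T`, in terms of which the Hertling–Manin and Euler conditions are stated. -/
def leibnizDefect (T : BilField n X) (ξ ζ θ : VField n X) : VField n X := fun x =>
  bracket ξ (prod T ζ θ) x - T x (bracket ξ ζ x) (θ x) - T x (ζ x) (bracket ξ θ x)

/-- The map `F` to a commutative algebra is a coordinate map that turns the product `T` into the
multiplication, `L` into the multiplication by the constant `a`, and `M` into the multiplication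
by `F` itself; the latter because `M` is the polynomial in `L` whose value at `a` is `F`. -/
structure IsAlgebraChart (L M : OpField n X) (T : BilField n X) (a : R) (F : X → R) (U : Set X) :
    Prop extends IsCoordinateMap n F U where
  map_L : ∀ x ∈ U, ∀ v, mvfderiv 𝓘(ℝ, Model n) F x (L x v) = a * mvfderiv 𝓘(ℝ, Model n) F x v
  exists_eq_evalDesc : ∀ x ∈ U, ∃ c : Fin n → ℝ, M x = evalDesc (L x) c ∧ F x = evalDesc a c
  map_mul : ∀ x ∈ U, ∀ u v, mvfderiv 𝓘(ℝ, Model n) F x (T x u v)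
    = mvfderiv 𝓘(ℝ, Model n) F x u * mvfderiv 𝓘(ℝ, Model n) F x v
  linearIndependent_pow : LinearIndependent ℝ fun k : Fin n => a ^ (k : ℕ)

namespace IsAlgebraChart

variable {L M : OpField n X} {T : BilField n X} {a : R} {F : X → R} {U : Set X} {e : VField n X}
  {x : X}

lemma mono (C : IsAlgebraChart L M T a F U) {U' : Set X} (hU' : IsOpen U') (h : U' ⊆ U) :
    IsAlgebraChart L M T a F U' where
  toIsCoordinateMap := C.toIsCoordinateMap.mono hU' h
  map_L x hx := C.map_L x (h hx)
  exists_eq_evalDesc x hx := C.exists_eq_evalDesc x (h hx)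
  map_mul x hx := C.map_mul x (h hx)
  linearIndependent_pow := C.linearIndependent_pow

lemma map_M_of_map_L (C : IsAlgebraChart L M T a F U) (hx : x ∈ U) (D : Tan n x →ₗ[ℝ] R)
    (hD : ∀ v, D (L x v) = a * D v) (v : Tan n x) : D (M x v) = F x * D v := by
  obtain ⟨c, hM, hF⟩ := C.exists_eq_evalDesc x hx
  rw [hM, hF]
  exact map_evalDesc_smul (a := L x) (a' := a) D hD c v

lemma isMulBy_L (C : IsAlgebraChart L M T a F U) : IsMulBy F U L (fun _ => a) 0 where
  contMDiffOn := contMDiffOn_const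
  map_app := C.map_L
  mvfderiv_eq x _ v := by simp [mvfderiv_const]

lemma isMulBy_M (C : IsAlgebraChart L M T a F U) : IsMulBy F U M F 1 where
  contMDiffOn := C.contMDiffOn
  map_app x hx := C.map_M_of_map_L hx (mvfderiv 𝓘ₙ F x) (C.map_L x hx)
  mvfderiv_eq x _ v := by rw [Pi.one_apply, one_mul]

lemma mul_comm (C : IsAlgebraChart L M T a F U) (hx : x ∈ U) (u v : Tan n x) :
    T x u v = T x v u := by
  apply (C.bijective x hx).1
  simp only [C.map_mul x hx, _root_.mul_comm]

lemma mul_assoc (C : IsAlgebraChart L M T a F U) (hx : x ∈ U) (u v w : Tan n x) :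
    T x (T x u v) w = T x u (T x v w) := by
  apply (C.bijective x hx).1
  simp only [C.map_mul x hx, _root_.mul_assoc]

lemma mul_eq_self_iff (C : IsAlgebraChart L M T a F U) (hx : x ∈ U) (u : Tan n x) :
    (∀ v, T x u v = v) ↔ mvfderiv 𝓘ₙ F x u = 1 := by
  refine ⟨fun h => ?_, fun h v => (C.bijective x hx).1 (by rw [C.map_mul x hx, h, one_mul])⟩
  obtain ⟨w, hw⟩ := (C.bijective x hx).2 1
  rw [← hw, ← h w, C.map_mul x hx, hw, mul_one]

lemma linearIndependent_pow_apply (C : IsAlgebraChart L M T a F U) (hx : x ∈ U) {u : Tan n x}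
    (hu : mvfderiv 𝓘ₙ F x u = 1) : LinearIndependent ℝ fun k : Fin n => ((L x) ^ (k : ℕ)) u := by
  have hpow (k : ℕ) : mvfderiv 𝓘ₙ F x (((L x) ^ k) u) = a ^ k := by
    induction k with
    | zero => rwa [pow_zero, pow_zero]
    | succ k ih => rw [pow_succ', mul_apply_eq_comp, C.map_L x hx, ih, pow_succ']
  have h := C.linearIndependent_pow
  simp only [← hpow] at h
  exact LinearIndependent.of_comp (mvfderiv 𝓘ₙ F x : Tan n x →ₗ[ℝ] R) h

variable [IsManifold 𝓘(ℝ, Model n) ∞ X] {V W ξ η ζ θ : VField n X}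

lemma smoothVFieldOn_prod (C : IsAlgebraChart L M T a F U) (hV : SmoothVFieldOn V U)
    (hW : SmoothVFieldOn W U) : SmoothVFieldOn (prod T V W) U :=
  C.smoothVFieldOn_of_lieDeriv <|
    (contMDiffOn_ring_mul (contMDiffOn_lieDeriv C.isOpen C.contMDiffOn hV)
      (contMDiffOn_lieDeriv C.isOpen C.contMDiffOn hW)).congr fun y hy => C.map_mul y hy (V y) (W y)

lemma mvfderiv_lieDeriv_prod (C : IsAlgebraChart L M T a F U) (hV : SmoothVFieldOn V U)
    (hW : SmoothVFieldOn W U) (hx : x ∈ U) (v : Tan n x) :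
    mvfderiv 𝓘ₙ (lieDeriv F (prod T V W)) x v
      = lieDeriv F V x * mvfderiv 𝓘ₙ (lieDeriv F W) x v
        + lieDeriv F W x * mvfderiv 𝓘ₙ (lieDeriv F V) x v := by
  have hev : lieDeriv F (prod T V W) =ᶠ[𝓝 x] fun y => lieDeriv F V y * lieDeriv F W y := by
    filter_upwards [C.isOpen.mem_nhds hx] with y hy using C.map_mul y hy (V y) (W y)
  rw [mvfderiv_apply_congr hev, mvfderiv_ring_mul (C.mdifferentiableAt_lieDeriv hV hx)
    (C.mdifferentiableAt_lieDeriv hW hx)]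

lemma map_leibnizDefect (C : IsAlgebraChart L M T a F U) (hξ : SmoothVFieldOn ξ U)
    (hζ : SmoothVFieldOn ζ U) (hθ : SmoothVFieldOn θ U) (hx : x ∈ U) :
    mvfderiv 𝓘ₙ F x (leibnizDefect T ξ ζ θ x)
      = lieDeriv F ζ x * mvfderiv 𝓘ₙ (lieDeriv F ξ) x (θ x)
        + lieDeriv F θ x * mvfderiv 𝓘ₙ (lieDeriv F ξ) x (ζ x)
        - mvfderiv 𝓘ₙ (lieDeriv F ξ) x (T x (ζ x) (θ x)) := by
  simp only [leibnizDefect, map_sub, C.map_mul x hx, C.map_bracket hξ hζ hx,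
    C.map_bracket hξ hθ hx, C.map_bracket hξ (C.smoothVFieldOn_prod hζ hθ) hx,
    C.mvfderiv_lieDeriv_prod hζ hθ hx]
  simp only [lieDeriv]
  ring

lemma leibnizDefect_prod (C : IsAlgebraChart L M T a F U) (hξ : SmoothVFieldOn ξ U)
    (hη : SmoothVFieldOn η U) (hζ : SmoothVFieldOn ζ U) (hθ : SmoothVFieldOn θ U) (hx : x ∈ U) :
    leibnizDefect T (prod T ξ η) ζ θ x
      = T x (ξ x) (leibnizDefect T η ζ θ x) + T x (η x) (leibnizDefect T ξ ζ θ x) := by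
  apply (C.bijective x hx).1
  simp only [map_add, C.map_mul x hx, C.map_leibnizDefect hξ hζ hθ hx,
    C.map_leibnizDefect hη hζ hθ hx,
    C.map_leibnizDefect (C.smoothVFieldOn_prod hξ hη) hζ hθ hx, C.mvfderiv_lieDeriv_prod hξ hη hx]
  simp only [lieDeriv]
  ring

lemma leibnizDefect_euler (C : IsAlgebraChart L M T a F U) (hes : SmoothVFieldOn e U)
    (he : ∀ y ∈ U, lieDeriv F e y = 1) (hζ : SmoothVFieldOn ζ U) (hθ : SmoothVFieldOn θ U)
    (hx : x ∈ U) : leibnizDefect T (app M e) ζ θ x = T x (ζ x) (θ x) := by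
  apply (C.bijective x hx).1
  simp only [C.map_leibnizDefect (C.isMulBy_M.smoothVFieldOn_app C.toIsCoordinateMap hes) hζ hθ hx,
    C.isMulBy_M.mvfderiv_lieDeriv_app C.toIsCoordinateMap hes hx,
    mvfderiv_apply_eq_zero_of_forall_eq C.isOpen he hx, he x hx, C.map_mul x hx, Pi.one_apply]
  simp only [lieDeriv]
  ring

lemma bracket_app_sub_of_unity {A : OpField n X} {h h' : X → R} (C : IsAlgebraChart L M T a F U)
    (hA : IsMulBy F U A h h') (hes : SmoothVFieldOn e U) (he : ∀ y ∈ U, lieDeriv F e y = 1)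
    (hV : SmoothVFieldOn V U) (hx : x ∈ U) :
    mvfderiv 𝓘ₙ F x (bracket e (app A V) x - A x (bracket e V x)) = h' x * lieDeriv F V x := by
  rw [hA.map_bracket_app_sub C.toIsCoordinateMap hes hV hx, he x hx,
    mvfderiv_apply_eq_zero_of_forall_eq C.isOpen he hx,
    mvfderiv_apply_eq_zero_of_forall_eq C.isOpen he hx]
  ring

lemma lieDeriv_eq_one (C : IsAlgebraChart L M T a F U) (hes : SmoothVFieldOn e U)
    (hL : LieDerivEq e L fun _ => 0)
    (hM : LieDerivEq e M fun x => ContinuousLinearMap.id ℝ (Tan n x)) (hx : x ∈ U) :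
    lieDeriv F e x = 1 := by
  have hcommute : ∀ v, mvfderiv 𝓘ₙ (lieDeriv F e) x (M x v)
      = F x * mvfderiv 𝓘ₙ (lieDeriv F e) x v := by
    refine C.map_M_of_map_L hx (mvfderiv 𝓘ₙ (lieDeriv F e) x) fun v => ?_
    obtain ⟨V, hV, rfl⟩ := C.exists_smoothVFieldOn_apply_eq hx v
    have h := C.isMulBy_L.map_bracket_app_sub C.toIsCoordinateMap hes hV hx
    rw [hL U C.isOpen V hV x hx] at h
    simp only [zero_apply, map_zero, Pi.zero_apply] at h
    linear_combination h
  obtain ⟨v, hv⟩ := (C.bijective x hx).2 1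
  obtain ⟨V, hV, rfl⟩ := C.exists_smoothVFieldOn_apply_eq hx v
  have h := C.isMulBy_M.map_bracket_app_sub C.toIsCoordinateMap hes hV hx
  rw [hM U C.isOpen V hV x hx, hcommute, ContinuousLinearMap.id_apply, hv,
    show lieDeriv F V x = 1 from hv] at h
  simp only [Pi.one_apply] at h
  linear_combination -h

end IsAlgebraChart

end AlgebraChart

section HasAlgebraCharts

variable {n : ℕ} {X : Type*} [TopologicalSpace X] [ChartedSpace (Model n) X]

/-- Algebra charts for `(L, M, T)`, with values in possibly different algebras, exist around every
point. -/
def HasAlgebraCharts (L M : OpField n X) (T : BilField n X) : Prop :=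
  ∀ p : X, ∃ (R : Type) (_ : NormedCommRing R) (_ : NormedAlgebra ℝ R) (a : R) (F : X → R)
    (U : Set X), p ∈ U ∧ IsAlgebraChart L M T a F U

namespace HasAlgebraCharts

variable {L M : OpField n X} {T : BilField n X} {e : VField n X} {U : Set X} {x : X}

lemma exists_subset (hC : HasAlgebraCharts L M T) (hU : IsOpen U) (hx : x ∈ U) :
    ∃ (R : Type) (_ : NormedCommRing R) (_ : NormedAlgebra ℝ R) (a : R) (F : X → R) (U' : Set X),
      U' ⊆ U ∧ x ∈ U' ∧ IsAlgebraChart L M T a F U' := by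
  obtain ⟨R, _, _, a, F, U', hx', C⟩ := hC x
  exact ⟨R, _, _, a, F, U ∩ U', Set.inter_subset_left, ⟨hx, hx'⟩,
    C.mono (hU.inter C.isOpen) Set.inter_subset_right⟩

lemma mul_comm (hC : HasAlgebraCharts L M T) (x : X) (u v : Tan n x) : T x u v = T x v u := by
  obtain ⟨R, _, _, a, F, U, hx, C⟩ := hC x
  exact C.mul_comm hx u v

lemma mul_assoc (hC : HasAlgebraCharts L M T) (x : X) (u v w : Tan n x) :
    T x (T x u v) w = T x u (T x v w) := by
  obtain ⟨R, _, _, a, F, U, hx, C⟩ := hC x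
  exact C.mul_assoc hx u v w

lemma exists_unity (hC : HasAlgebraCharts L M T) :
    ∃ e : VField n X, ∀ x v, T x (e x) v = v := by
  suffices h : ∀ x, ∃ u : Tan n x, ∀ v, T x u v = v from Classical.skolem.1 h
  intro x
  obtain ⟨R, _, _, a, F, U, hx, C⟩ := hC x
  obtain ⟨u, hu⟩ := (C.bijective x hx).2 1
  exact ⟨u, (C.mul_eq_self_iff hx u).2 hu⟩

variable [IsManifold 𝓘(ℝ, Model n) ∞ X]

lemma smoothVFieldOn_of_chart (hC : HasAlgebraCharts L M T) (hU : IsOpen U) {V : VField n X}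
    (h : ∀ {R : Type} [NormedCommRing R] [NormedAlgebra ℝ R] {a : R} {F : X → R} {U' : Set X},
      U' ⊆ U → IsAlgebraChart L M T a F U' → SmoothVFieldOn V U') : SmoothVFieldOn V U := by
  intro x hx
  obtain ⟨R, _, _, a, F, U', hU', hx', C⟩ := hC.exists_subset hU hx
  exact ((h hU' C).contMDiffAt (C.isOpen.mem_nhds hx')).contMDiffWithinAt

lemma smoothVFieldOn_prod (hC : HasAlgebraCharts L M T) (hU : IsOpen U) {V W : VField n X}
    (hV : SmoothVFieldOn V U) (hW : SmoothVFieldOn W U) : SmoothVFieldOn (prod T V W) U :=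
  hC.smoothVFieldOn_of_chart hU fun hU' C => C.smoothVFieldOn_prod (hV.mono hU') (hW.mono hU')

lemma smoothVField_app (hC : HasAlgebraCharts L M T) {V : VField n X} (hV : SmoothVField V) :
    SmoothVField (app M V) :=
  contMDiffOn_univ.1 <| hC.smoothVFieldOn_of_chart isOpen_univ fun _ C =>
    C.isMulBy_M.smoothVFieldOn_app C.toIsCoordinateMap hV.contMDiffOn

lemma smoothVField_of_unity (hC : HasAlgebraCharts L M T) (he : ∀ x v, T x (e x) v = v) :
    SmoothVField e :=
  contMDiffOn_univ.1 <| hC.smoothVFieldOn_of_chart isOpen_univ fun _ C =>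
    C.smoothVFieldOn_of_lieDeriv <| contMDiffOn_const.congr fun y hy =>
      (C.mul_eq_self_iff hy (e y)).1 (he y)

lemma isUnityFor_iff (hC : HasAlgebraCharts L M T) :
    IsUnityFor L M e ↔ ∀ x v, T x (e x) v = v := by
  refine ⟨fun he x => ?_, fun he => ?_⟩
  · obtain ⟨R, _, _, a, F, U, hx, C⟩ := hC x
    exact (C.mul_eq_self_iff hx (e x)).2
      (C.lieDeriv_eq_one he.smooth.contMDiffOn he.lie_L he.lie_M hx)
  have hes := hC.smoothVField_of_unity he
  refine ⟨hes, fun x => ?_, fun U hU V hV x hx => ?_, fun U hU V hV x hx => ?_⟩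
  · obtain ⟨R, _, _, a, F, U, hx, C⟩ := hC x
    exact C.linearIndependent_pow_apply hx ((C.mul_eq_self_iff hx (e x)).1 (he x))
  all_goals
    obtain ⟨R, _, _, a, F, U', hU', hx', C⟩ := hC.exists_subset hU hx
    have he' (y) (hy : y ∈ U') : lieDeriv F e y = 1 := (C.mul_eq_self_iff hy (e y)).1 (he y)
    apply (C.bijective x hx').1
  · rw [C.bracket_app_sub_of_unity C.isMulBy_L hes.contMDiffOn he' (hV.mono hU') hx', zero_apply,
      map_zero, Pi.zero_apply, zero_mul]
  · rw [C.bracket_app_sub_of_unity C.isMulBy_M hes.contMDiffOn he' (hV.mono hU') hx',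
      Pi.one_apply, one_mul]
    rfl

lemma existsUnique_isUnityFor (hC : HasAlgebraCharts L M T) :
    ∃! e : VField n X, IsUnityFor L M e := by
  obtain ⟨e, he⟩ := hC.exists_unity
  refine ⟨e, hC.isUnityFor_iff.2 he, fun e' he' => funext fun x => ?_⟩
  rw [← he x (e' x), hC.mul_comm, hC.isUnityFor_iff.1 he']

lemma isFManifold (hC : HasAlgebraCharts L M T) (he : ∀ x v, T x (e x) v = v) :
    IsFManifold T e (app M e) where
  smooth_mul _ hU _ _ hV hW := hC.smoothVFieldOn_prod hU hV hW
  smooth_unity := hC.smoothVField_of_unity he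
  smooth_euler := hC.smoothVField_app (hC.smoothVField_of_unity he)
  comm := hC.mul_comm
  assoc := hC.mul_assoc
  unity := he
  hertling_manin U hU ξ η ζ θ hξ hη hζ hθ x hx := by
    obtain ⟨R, _, _, a, F, U', hU', hx', C⟩ := hC.exists_subset hU hx
    have h := C.leibnizDefect_prod (hξ.mono hU') (hη.mono hU') (hζ.mono hU') (hθ.mono hU') hx'
    simp only [leibnizDefect, map_sub] at h
    simp only [hC.mul_assoc]
    rw [sub_sub, sub_eq_iff_eq_add] at h
    rw [h]
    abel
  euler U hU ξ η hξ hη x hx := by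
    obtain ⟨R, _, _, a, F, U', hU', hx', C⟩ := hC.exists_subset hU hx
    exact C.leibnizDefect_euler (hC.smoothVField_of_unity he).contMDiffOn
      (fun y hy => (C.mul_eq_self_iff hy (e y)).1 (he y)) (hξ.mono hU') (hη.mono hU') hx'

lemma isNijenhuis (hC : HasAlgebraCharts L M T) : IsNijenhuis M := by
  intro U hU V W hV hW x hx
  obtain ⟨R, _, _, a, F, U', hU', hx', C⟩ := hC.exists_subset hU hx
  exact C.isMulBy_M.torsion_eq_zero C.toIsCoordinateMap (hV.mono hU') (hW.mono hU') hx'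

end HasAlgebraCharts

end HasAlgebraCharts

section ConstantChart

open Topology IsCoordinateMap

variable {n : ℕ}

lemma surjective_pi_of_linearIndependent {K V ι : Type*} [Field K] [AddCommGroup V] [Module K V]
    [Finite ι] {f : ι → V →ₗ[K] K} (hf : LinearIndependent K f) :
    Function.Surjective (LinearMap.pi f) := by
  classical
  have := Fintype.ofFinite ι
  refine LinearMap.dualMap_injective_iff.1 ((injective_iff_map_eq_zero _).2 fun g hg => ?_)
  have hsum : ∑ i, g (Pi.single i 1) • f i = 0 := by
    ext v
    calc (∑ i, g (Pi.single i 1) • f i) v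
        = g (∑ i, f i v • Pi.single i (1 : K)) := by simp [mul_comm]
      _ = g (LinearMap.pi f v) := by rw [← pi_eq_sum_univ']; rfl
      _ = 0 := DFunLike.congr_fun hg v
  refine LinearMap.pi_ext' fun i => LinearMap.ext_ring ?_
  exact Fintype.linearIndependent_iff.1 hf _ hsum i

variable {X : Type*} [TopologicalSpace X] [ChartedSpace (Model n) X]

local notation "𝓘ₙ" => 𝓘(ℝ, Model n)

/-- The coefficients of `M` in the powers of `L`, collected into a vector-valued function. -/
def coeffMap (L M : OpField n X) (x : X) : Fin n → ℝ := fun i => coeff L M i x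

/-- `M` is the linear combination of the powers of `L` with the coefficients `coeff L M i`. -/
def IsExpandable (L M : OpField n X) : Prop :=
  ∀ x, M x = evalDesc (L x) (coeffMap L M x)

variable {L M : OpField n X} {x : X}

lemma isExpansionAt_iff_eq_evalDesc {c : Fin n → ℝ} :
    IsExpansionAt L M x c ↔ M x = evalDesc (L x) c := by
  rw [IsExpansionAt, evalDesc_apply]

lemma IsGlRegular.exists_linearIndependent_pow (hL : IsGlRegular L) (x : X) :
    ∃ v : Tan n x, LinearIndependent ℝ fun k : Fin n => (L x) ^ (k : ℕ) • v := by
  obtain ⟨v, hv⟩ := exists_linearIndependent_pow_apply ℂ (L x : Tan n x →ₗ[ℝ] Tan n x) fun μ => by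
    by_cases h : Module.End.HasEigenvalue ((L x : Tan n x →ₗ[ℝ] Tan n x).baseChange ℂ) μ
    · exact (hL x μ h).le
    · rw [Module.End.hasEigenvalue_iff, not_not] at h
      rw [h, finrank_bot]
      exact zero_le_one
  have hcast : (fun k : Fin n => (L x) ^ (k : ℕ) • v)
      = (fun k : Fin (Module.finrank ℝ (Tan n x)) => ((L x : Tan n x →ₗ[ℝ] Tan n x) ^ (k : ℕ)) v)
        ∘ Fin.cast (finrank_tan x).symm := funext fun k => by
    rw [Function.comp_apply, Fin.val_cast, ← ContinuousLinearMap.toLinearMap_pow]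
    rfl
  exact ⟨v, hcast ▸ hv.comp _ (Fin.cast_injective _)⟩

lemma isExpansionAt_iff_eq_coeff (hL : IsGlRegular L) (hLM : ∀ x v, L x (M x v) = M x (L x v))
    (x : X) (c : Fin n → ℝ) : IsExpansionAt L M x c ↔ c = fun i => coeff L M i x := by
  obtain ⟨v, hv⟩ := hL.exists_linearIndependent_pow x
  have hcomm : Commute (M x) (L x) := ContinuousLinearMap.ext fun u => (hLM x u).symm
  have huniq := existsUnique_eq_evalDesc (finrank_tan x) hv hcomm
  simp only [← isExpansionAt_iff_eq_evalDesc] at huniq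
  have hcoeff : IsExpansionAt L M x fun i => coeff L M i x := by
    simp only [coeff, dif_pos huniq.exists]
    exact huniq.exists.choose_spec
  exact ⟨fun h => huniq.unique h hcoeff, fun h => h ▸ hcoeff⟩

lemma differential_coeff_eq (hg : MDifferentiableAt 𝓘ₙ 𝓘(ℝ, Fin n → ℝ) (coeffMap L M) x)
    (i : Fin n) (u : Tan n x) :
    differential (n := n) (coeff L M i) x u = mvfderiv 𝓘ₙ (coeffMap L M) x u i :=
  mvfderiv_clm_comp (ContinuousLinearMap.proj (R := ℝ) (φ := fun _ : Fin n => ℝ) i) hg u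

lemma symmetryTensor_apply (hg : MDifferentiableAt 𝓘ₙ 𝓘(ℝ, Fin n → ℝ) (coeffMap L M) x)
    (u : Tan n x) :
    symmetryTensor L M x u = evalDesc (L x) (mvfderiv 𝓘ₙ (coeffMap L M) x u) := by
  simp only [symmetryTensor, sum_apply, evalDesc_apply, ← differential_coeff_eq hg]
  rfl

/-- The element of an algebra obtained by putting `a` for `L` in the expansion of `M`. -/
def symbol {R : Type*} [Ring R] [Algebra ℝ R] (L M : OpField n X) (a : R) (x : X) : R :=
  evalDesc a (coeffMap L M x)

lemma mvfderiv_symbol {R : Type*} [NormedRing R] [NormedAlgebra ℝ R]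
    (hg : MDifferentiableAt 𝓘ₙ 𝓘(ℝ, Fin n → ℝ) (coeffMap L M) x) (a : R) (v : Tan n x) :
    mvfderiv 𝓘ₙ (symbol L M a) x v = evalDesc a (mvfderiv 𝓘ₙ (coeffMap L M) x v) :=
  mvfderiv_clm_comp (LinearMap.toContinuousLinearMap (evalDesc a)) hg v

lemma bijective_mvfderiv_coeffMap
    (hg : MDifferentiableAt 𝓘ₙ 𝓘(ℝ, Fin n → ℝ) (coeffMap L M) x)
    (hd : LinearIndependent ℝ fun i => differential (n := n) (coeff L M i) x) :
    Function.Bijective (mvfderiv 𝓘ₙ (coeffMap L M) x) := by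
  have hd' : LinearIndependent ℝ fun i =>
      (differential (n := n) (coeff L M i) x : Tan n x →ₗ[ℝ] ℝ) :=
    hd.map' (ContinuousLinearMap.coeLM ℝ)
      (LinearMap.ker_eq_bot.2 ContinuousLinearMap.coe_injective)
  have hpi : (mvfderiv 𝓘ₙ (coeffMap L M) x : Tan n x →ₗ[ℝ] Fin n → ℝ)
      = LinearMap.pi fun i => (differential (n := n) (coeff L M i) x : Tan n x →ₗ[ℝ] ℝ) :=
    LinearMap.ext fun u => funext fun i => (differential_coeff_eq hg i u).symm
  have hsurj : Function.Surjective (mvfderiv 𝓘ₙ (coeffMap L M) x : Tan n x →ₗ[ℝ] Fin n → ℝ) :=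
    hpi ▸ surjective_pi_of_linearIndependent hd'
  exact ⟨(LinearMap.injective_iff_surjective_of_finrank_eq_finrank
    (by rw [finrank_tan, Module.finrank_fin_fun])).2 hsurj, hsurj⟩

/-- A coordinate map `φ` with values in a module, in which `L` acts as the scalar `a`. -/
structure IsConstantChart {R B : Type*} [Ring R] [NormedAddCommGroup B] [NormedSpace ℝ B]
    [Module R B] (L : OpField n X) (a : R) (φ : X → B) (U : Set X) : Prop
    extends IsCoordinateMap n φ U where
  map_L : ∀ x ∈ U, ∀ v, mvfderiv 𝓘(ℝ, Model n) φ x (L x v) = a • mvfderiv 𝓘(ℝ, Model n) φ x v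

namespace IsConstantChart

variable {R B : Type*} [NormedAddCommGroup B] [NormedSpace ℝ B] {a : R} {φ : X → B} {U : Set X}

section Ring

variable [Ring R] [Module R B]

lemma exists_linearIndependent_pow_smul (C : IsConstantChart L a φ U) (hL : IsGlRegular L)
    (hx : x ∈ U) : ∃ w : B, LinearIndependent ℝ fun k : Fin n => a ^ (k : ℕ) • w := by
  obtain ⟨v, hv⟩ := hL.exists_linearIndependent_pow x
  have hpow (k : ℕ) : mvfderiv 𝓘ₙ φ x ((L x) ^ k • v) = a ^ k • mvfderiv 𝓘ₙ φ x v := by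
    induction k with
    | zero => simp
    | succ k ih =>
      rw [pow_succ', mul_smul, pow_succ', mul_smul, ← ih]
      exact C.map_L x hx _
  refine ⟨mvfderiv 𝓘ₙ φ x v, ?_⟩
  simp only [← hpow]
  exact hv.map' (mvfderiv 𝓘ₙ φ x : Tan n x →ₗ[ℝ] B)
    (LinearMap.ker_eq_bot.2 (C.bijective x hx).1)

variable [Algebra ℝ R] [IsScalarTower ℝ R B]

lemma map_evalDesc (C : IsConstantChart L a φ U) (hx : x ∈ U) (c : Fin n → ℝ) (v : Tan n x) :
    mvfderiv 𝓘ₙ φ x (evalDesc (L x) c v) = evalDesc a c • mvfderiv 𝓘ₙ φ x v :=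
  map_evalDesc_smul (a := L x) (mvfderiv 𝓘ₙ φ x : Tan n x →ₗ[ℝ] B) (C.map_L x hx) c v

lemma lieDeriv_app_constField (C : IsConstantChart L a φ U) (hLM : IsExpandable L M) (hx : x ∈ U)
    (c : B) : lieDeriv φ (app M (constField n φ c)) x = symbol L M a x • c := by
  rw [lieDeriv, app, hLM x, C.map_evalDesc hx, ← lieDeriv, C.lieDeriv_constField hx]
  rfl

lemma contMDiffOn_coeffMap [IsManifold 𝓘ₙ ∞ X] (C : IsConstantChart L a φ U) (hL : IsGlRegular L)
    (hM : SmoothOpField M) (hLM : IsExpandable L M) :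
    ContMDiffOn 𝓘ₙ 𝓘(ℝ, Fin n → ℝ) ∞ (coeffMap L M) U := by
  intro x hx
  have := C.finiteDimensional hx
  obtain ⟨w, hw⟩ := C.exists_linearIndependent_pow_smul hL hx
  let l : (Fin n → ℝ) →ₗ[ℝ] B :=
    (LinearMap.toSpanSingleton R B w).restrictScalars ℝ ∘ₗ evalDesc a
  let l' : B →L[ℝ] Fin n → ℝ := LinearMap.toContinuousLinearMap <|
    (LinearEquiv.ofBijective l (evalDesc_smul_bijective (C.finrank_eq hx) hw)).symm
  have hl (y) (hy : y ∈ U) : coeffMap L M y = l' (lieDeriv φ (app M (constField n φ w)) y) := by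
    rw [C.lieDeriv_app_constField hLM hy]
    exact (LinearEquiv.symm_apply_apply (LinearEquiv.ofBijective l _) _).symm
  have hsmooth := contMDiffOn_lieDeriv C.isOpen C.contMDiffOn
    (smoothVFieldOn_app hM (C.smoothVFieldOn_constField w))
  exact (l'.contMDiff.comp_contMDiffOn hsmooth).congr hl x hx

end Ring

section NormedRing

variable [NormedRing R] [NormedAlgebra ℝ R] [Module R B] [IsScalarTower ℝ R B]

lemma mvfderiv_symbol_smul (C : IsConstantChart L a φ U) (hx : x ∈ U)
    (hg : MDifferentiableAt 𝓘ₙ 𝓘(ℝ, Fin n → ℝ) (coeffMap L M) x) (u v : Tan n x) :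
    mvfderiv 𝓘ₙ (symbol L M a) x u • mvfderiv 𝓘ₙ φ x v
      = mvfderiv 𝓘ₙ φ x (symmetryTensor L M x u v) := by
  rw [mvfderiv_symbol hg, symmetryTensor_apply hg, C.map_evalDesc hx]

lemma mvfderiv_lieDeriv_app_constField (C : IsConstantChart L a φ U) (hLM : IsExpandable L M)
    (hg : ContMDiffOn 𝓘ₙ 𝓘(ℝ, Fin n → ℝ) ∞ (coeffMap L M) U) (hx : x ∈ U) (c : B) (v : Tan n x) :
    mvfderiv 𝓘ₙ (lieDeriv φ (app M (constField n φ c))) x v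
      = mvfderiv 𝓘ₙ (symbol L M a) x v • c := by
  let l : (Fin n → ℝ) →L[ℝ] B := LinearMap.toContinuousLinearMap
    ((LinearMap.toSpanSingleton R B c).restrictScalars ℝ ∘ₗ evalDesc a)
  have hev : lieDeriv φ (app M (constField n φ c)) =ᶠ[𝓝 x] fun y => l (coeffMap L M y) := by
    filter_upwards [C.isOpen.mem_nhds hx] with y hy using C.lieDeriv_app_constField hLM hy c
  rw [mvfderiv_apply_congr hev,
    mvfderiv_clm_comp l (mdifferentiableAt_of_contMDiffOn C.isOpen hg hx),
    mvfderiv_symbol (mdifferentiableAt_of_contMDiffOn C.isOpen hg hx)]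
  rfl

variable [IsManifold 𝓘(ℝ, Model n) ∞ X]

lemma symmetryTensor_diag (C : IsConstantChart L a φ U) (hMs : SmoothOpField M)
    (hLM : IsExpandable L M) (hg : ContMDiffOn 𝓘ₙ 𝓘(ℝ, Fin n → ℝ) ∞ (coeffMap L M) U)
    (hM : IsSymmetry L M) (hx : x ∈ U) (u : Tan n x) :
    symmetryTensor L M x (L x u) u = L x (symmetryTensor L M x u u) := by
  obtain ⟨c, rfl⟩ : ∃ c, constField n φ c x = u :=
    ⟨mvfderiv 𝓘ₙ φ x u, (C.bijective x hx).1 (C.lieDeriv_constField hx _)⟩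
  set V : VField n X := constField n φ c
  have hV : SmoothVFieldOn V U := C.smoothVFieldOn_constField c
  have hφV (y) (hy : y ∈ U) : lieDeriv φ V y = c := C.lieDeriv_constField hy c
  have hφLV (y) (hy : y ∈ U) : lieDeriv φ (app L V) y = a • c := by
    rw [← hφV y hy]; exact C.map_L y hy _
  have hLV : SmoothVFieldOn (app L V) U :=
    C.smoothVFieldOn_of_lieDeriv (contMDiffOn_const.congr hφLV)
  have hMV : SmoothVFieldOn (app M V) U := smoothVFieldOn_app hMs hV
  have hdV := mvfderiv_apply_eq_zero_of_forall_eq (n := n) C.isOpen hφV hx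
  have hdLV := mvfderiv_apply_eq_zero_of_forall_eq (n := n) C.isOpen hφLV hx
  have hT (v : Tan n x) : mvfderiv 𝓘ₙ φ x (symmetryTensor L M x v (V x))
      = mvfderiv 𝓘ₙ (lieDeriv φ (app M V)) x v := by
    rw [← C.mvfderiv_symbol_smul hx (mdifferentiableAt_of_contMDiffOn C.isOpen hg hx), ← lieDeriv,
      hφV x hx, C.mvfderiv_lieDeriv_app_constField hLM hg hx]
  have h := congrArg (fun v : Tan n x => mvfderiv 𝓘ₙ φ x v) (hM.2 U C.isOpen V hV x hx)
  simp only [nijBracket, map_sub, map_add, map_zero, C.map_L x hx, hLM x, C.map_evalDesc hx,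
    C.map_bracket hLV hV hx, C.map_bracket hV hMV hx, C.map_bracket hLV hMV hx,
    C.map_bracket hV hV hx, hdV, hdLV, smul_zero, sub_zero, zero_add] at h
  apply (C.bijective x hx).1
  rw [C.map_L x hx, hT, hT]
  exact (sub_eq_zero.1 h).symm

lemma symmetryTensor_L (C : IsConstantChart L a φ U) (hL : IsGlRegular L) (hMs : SmoothOpField M)
    (hLM : IsExpandable L M) (hg : ContMDiffOn 𝓘ₙ 𝓘(ℝ, Fin n → ℝ) ∞ (coeffMap L M) U)
    (hM : IsSymmetry L M) (hx : x ∈ U) (u : Tan n x) :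
    symmetryTensor L M x (L x u) = L x * symmetryTensor L M x u := by
  obtain ⟨v, hv⟩ := hL.exists_linearIndependent_pow x
  refine map_smul_of_diag (a := L x) (finrank_tan x) hv
    (symmetryTensor L M x : Tan n x →ₗ[ℝ] Tan n x →L[ℝ] Tan n x) (fun u => ?_)
    (C.symmetryTensor_diag hMs hLM hg hM hx) u
  change Commute (symmetryTensor L M x u) (L x)
  rw [symmetryTensor_apply (mdifferentiableAt_of_contMDiffOn C.isOpen hg hx)]
  exact (commute_evalDesc (Commute.refl _) _).symm

lemma mvfderiv_symbol_apply_L [FaithfulSMul R B] (C : IsConstantChart L a φ U)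
    (hL : IsGlRegular L) (hMs : SmoothOpField M) (hLM : IsExpandable L M)
    (hg : ContMDiffOn 𝓘ₙ 𝓘(ℝ, Fin n → ℝ) ∞ (coeffMap L M) U) (hM : IsSymmetry L M) (hx : x ∈ U)
    (u : Tan n x) :
    mvfderiv 𝓘ₙ (symbol L M a) x (L x u) = a * mvfderiv 𝓘ₙ (symbol L M a) x u := by
  have hgx := mdifferentiableAt_of_contMDiffOn C.isOpen hg hx
  refine FaithfulSMul.eq_of_smul_eq_smul (α := B) fun y => ?_
  obtain ⟨v, rfl⟩ := (C.bijective x hx).2 y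
  rw [mul_smul, C.mvfderiv_symbol_smul hx hgx, C.mvfderiv_symbol_smul hx hgx,
    C.symmetryTensor_L hL hMs hLM hg hM hx, ← C.map_L x hx]
  rfl

end NormedRing

lemma isAlgebraChart [IsManifold 𝓘ₙ ∞ X] [NormedCommRing R] [NormedAlgebra ℝ R] [Module R B]
    [IsScalarTower ℝ R B] [FaithfulSMul R B] (C : IsConstantChart L a φ U) (hL : IsGlRegular L)
    (hMs : SmoothOpField M) (hLM : IsExpandable L M) (hM : IsRegularSymmetry L M)
    (hU : U.Nonempty) :
    IsAlgebraChart L M (symmetryTensor L M) a (symbol L M a) U := by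
  have hg := C.contMDiffOn_coeffMap hL hMs hLM
  have hgx (x) (hx : x ∈ U) := mdifferentiableAt_of_contMDiffOn C.isOpen hg hx
  have hFL (x) (hx : x ∈ U) := C.mvfderiv_symbol_apply_L hL hMs hLM hg hM.1 hx
  obtain ⟨p, hp⟩ := hU
  obtain ⟨w, hw⟩ := C.exists_linearIndependent_pow_smul hL hp
  have := C.finiteDimensional hp
  have hbij := evalDesc_bijective (C.finrank_eq hp) hw
  refine ⟨⟨C.isOpen, ?_, fun x hx => ?_⟩, hFL, fun x _ => ⟨_, hLM x, rfl⟩, fun x hx u v => ?_, ?_⟩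
  · exact (LinearMap.toContinuousLinearMap (evalDesc a)).contMDiff.comp_contMDiffOn hg
  · rw [show ⇑(mvfderiv 𝓘ₙ (symbol L M a) x) = _ from funext (mvfderiv_symbol (hgx x hx) a)]
    exact hbij.comp (bijective_mvfderiv_coeffMap (hgx x hx) (hM.2 x))
  · rw [symmetryTensor_apply (hgx x hx), mvfderiv_symbol (hgx x hx) a u]
    exact map_evalDesc_smul (a := L x) (a' := a)
      (mvfderiv 𝓘ₙ (symbol L M a) x : Tan n x →ₗ[ℝ] R) (hFL x hx) _ v
  · exact LinearIndependent.of_comp ((LinearMap.toSpanSingleton R B w).restrictScalars ℝ) hw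

end IsConstantChart

end ConstantChart

section Existence

variable {n : ℕ} {X : Type*} [TopologicalSpace X] [ChartedSpace (Model n) X]

instance isScalarTower_adjoin {V : Type*} [NormedAddCommGroup V] [NormedSpace ℝ V]
    (s : Set (V →L[ℝ] V)) : IsScalarTower ℝ (Algebra.adjoin ℝ s) V :=
  ⟨fun _ _ _ => rfl⟩

/-- The commutative normed algebra generated by a bounded operator. -/
abbrev adjoinNormedCommRing {V : Type*} [NormedAddCommGroup V] [NormedSpace ℝ V] (A : V →L[ℝ] V) :
    NormedCommRing (Algebra.adjoin ℝ {A}) where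
  mul_comm := (Algebra.isMulCommutative_adjoin ℝ (s := {A}) (by
    rintro a rfl b rfl; rfl)).is_comm.comm

lemma hasAlgebraCharts [IsManifold 𝓘(ℝ, Model n) ∞ X] {L M : OpField n X}
    (hL : IsGlRegular L) (hLc : IsConstantInCoordinates L) (hMs : SmoothOpField M)
    (hLM : IsExpandable L M) (hM : IsRegularSymmetry L M) :
    HasAlgebraCharts L M (symmetryTensor L M) := by
  intro p
  obtain ⟨φ, hφ, hp, A, hA⟩ := hLc p
  let R := Algebra.adjoin ℝ {A}
  let i₁ : NormedCommRing R := adjoinNormedCommRing A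
  let i₂ : NormedAlgebra ℝ R :=
    { (inferInstance : Algebra ℝ R) with
      norm_smul_le := fun c r => norm_smul_le c (r : Model n →L[ℝ] Model n) }
  let a : R := ⟨A, Algebra.self_mem_adjoin_singleton ℝ A⟩
  have C : IsConstantChart L a φ φ.source := ⟨.of_mem_maximalAtlas hφ, hA⟩
  exact ⟨R, i₁, i₂, a, _, φ.source, hp, C.isAlgebraChart hL hMs hLM hM ⟨p, hp⟩⟩

end Existence

end NijenhuisF

end

open NijenhuisF in
theorem proposition3p4 {n : ℕ} {X : Type*} [TopologicalSpace X] [ChartedSpace (Model n) X]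
    [IsManifold 𝓘(ℝ, Model n) ∞ X]
    (L M : OpField n X) (hLs : SmoothOpField L) (hMs : SmoothOpField M)
    (hLN : IsNijenhuis L) (hLreg : IsGlRegular L) (hLconst : IsConstantInCoordinates L)
    (hM : IsRegularSymmetry L M) :
    (∀ x, ∀ c : Fin n → ℝ, IsExpansionAt L M x c ↔ c = fun i => coeff L M i x) ∧
    (∃! e : VField n X, IsUnityFor L M e) ∧
    (∀ e : VField n X, IsUnityFor L M e →
      IsFManifold (symmetryTensor L M) e (app M e) ∧ IsNijenhuis M) := by
  have hexp := isExpansionAt_iff_eq_coeff hLreg hM.1.1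
  have hLM : IsExpandable L M := fun x => isExpansionAt_iff_eq_evalDesc.1 ((hexp x _).2 rfl)
  have hC := hasAlgebraCharts hLreg hLconst hMs hLM hM
  exact ⟨hexp, hC.existsUnique_isUnityFor, fun e he =>
    ⟨hC.isFManifold (hC.isUnityFor_iff.1 he), hC.isNijenhuis⟩⟩
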